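/- Let $H_3$ be the Heisenberg group $\mathbb{R}^3$ with product $(x,y,z)(x',y',z')=(x+x',\,y+y',\,z+z'+xy')$, with left-invariant coframe $\sigma=dx$, $\rho=dy$, $\zeta=x\,dy-dz$. On the $4$-manifold $M=H_3\times(0,\infty)$, with $\phi$ the coordinate on $(0,\infty)$, consider the (expanding gradient Kähler–Ricci soliton) metric \[ g=\phi\,(\sigma^2+\rho^2)+F(\phi)\,\zeta^2+\frac{1}{F(\phi)}\,d\phi^2,\qquad F(\phi)=\frac{4}{\phi}\Big(1-\phi+\frac{\phi^2}{2}-e^{-\phi}\Big). \] Then for every point $p\in M$ and every $2$-plane $\alpha\subset T_pM$ the sectional curvature of $g$ satisfies \[ -\frac23<\mathrm{Sec}(\alpha)<0 . \] Both bounds are sharp: over all points of $M$ and all tangent $2$-planes, the infimum of $\mathrm{Sec}(\alpha)$ is $-\frac23$ and the supremum is $0$. -/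

import Mathlib

open scoped ContDiff

noncomputable section

/-! ### Riemannian geometry in a global chart -/

/-- A smooth Riemannian metric on an open subset of `ℝ^ι`, given by the Gram matrix
`(g_{ij})` of the coordinate vector fields. -/
structure ChartMetric (ι : Type) [Fintype ι] [DecidableEq ι] where
  domain : Set (ι → ℝ)
  isOpen_domain : IsOpen domain
  gram : (ι → ℝ) → Matrix ι ι ℝ
  smooth : ∀ i j, ContDiffOn ℝ ∞ (fun p => gram p i j) domain
  posDef : ∀ p ∈ domain, (gram p).PosDef

/-- The partial derivative `∂_k f` at `p`. -/
def partialDeriv {ι : Type} [Fintype ι] [DecidableEq ι]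
    (f : (ι → ℝ) → ℝ) (k : ι) (p : ι → ℝ) : ℝ :=
  fderiv ℝ f p (Pi.single k 1)

namespace ChartMetric

variable {ι : Type} [Fintype ι] [DecidableEq ι]

/-- The inner product `g_p(u, v)` of tangent vectors given by their coordinate components. -/
def inner (g : ChartMetric ι) (p u v : ι → ℝ) : ℝ :=
  ∑ i, ∑ j, g.gram p i j * u i * v j

/-- The Christoffel symbol `Γ^l_{ij}` of the Levi-Civita connection. -/
def christoffel (g : ChartMetric ι) (l i j : ι) (p : ι → ℝ) : ℝ :=
  (1 / 2) * ∑ m, (g.gram p)⁻¹ l m *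
    (partialDeriv (fun q => g.gram q j m) i p
      + partialDeriv (fun q => g.gram q i m) j p
      - partialDeriv (fun q => g.gram q i j) m p)

/-- The component `R^l_{kij}` of the curvature tensor, `R(∂_i, ∂_j) ∂_k = ∑ l, R^l_{kij} ∂_l`,
with `R(X, Y) Z = ∇_X ∇_Y Z - ∇_Y ∇_X Z - ∇_[X,Y] Z`. -/
def riemann (g : ChartMetric ι) (l k i j : ι) (p : ι → ℝ) : ℝ :=
  partialDeriv (g.christoffel l j k) i p - partialDeriv (g.christoffel l i k) j p
    + ∑ m, (g.christoffel l i m p * g.christoffel m j k p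
      - g.christoffel l j m p * g.christoffel m i k p)

/-- The tangent vector `R(u, v) w` at `p`. -/
def curvature (g : ChartMetric ι) (p u v w : ι → ℝ) : ι → ℝ :=
  fun l => ∑ k, ∑ i, ∑ j, g.riemann l k i j p * u i * v j * w k

/-- The sectional curvature at `p` of the plane spanned by the (linearly independent) tangent
vectors `u`, `v`. -/
def sec (g : ChartMetric ι) (p u v : ι → ℝ) : ℝ :=
  g.inner p (g.curvature p u v v) u /
    (g.inner p u u * g.inner p v v - g.inner p u v ^ 2)

/-- The set of all values of the sectional curvature, over all points of the manifold and all
tangent planes. -/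
def secValues (g : ChartMetric ι) : Set ℝ :=
  {κ | ∃ p ∈ g.domain, ∃ u v : ι → ℝ, LinearIndependent ℝ ![u, v] ∧ κ = g.sec p u v}

end ChartMetric

/-! ### The Heisenberg soliton metric in complex dimension two

Coordinates on `M = H₃ × (0, ∞)` are `(x, y, z, φ) = (p 0, p 1, p 2, p 3)`, where `H₃` is `ℝ³`
with `(x, y, z) (x', y', z') = (x + x', y + y', z + z' + x y')`. -/

/-- `F_n(φ) = 2 (-1)^(n+1) (n+1)! φ⁻¹ (∑_{k=0}^{n+1} (-1)^k φ^k / k! - e^{-φ})`. -/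
def heisF (n : ℕ) (φ : ℝ) : ℝ :=
  2 * (-1) ^ (n + 1) * ((n + 1).factorial : ℝ) * (1 / φ) *
    ((∑ k ∈ Finset.range (n + 2), (-1) ^ k / (k.factorial : ℝ) * φ ^ k) - Real.exp (-φ))

/-- The left-invariant 1-form `σ = dx`. -/
def coframeSigma : Fin 4 → ℝ := ![1, 0, 0, 0]

/-- The left-invariant 1-form `ρ = dy`. -/
def coframeRho : Fin 4 → ℝ := ![0, 1, 0, 0]

/-- The left-invariant 1-form `ζ = x dy - dz`. -/
def coframeZeta (p : Fin 4 → ℝ) : Fin 4 → ℝ := ![0, p 0, -1, 0]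

/-- The 1-form `dφ`. -/
def coframePhi : Fin 4 → ℝ := ![0, 0, 0, 1]

/-- The Gram matrix of `φ (σ² + ρ²) + F₁(φ) ζ² + F₁(φ)⁻¹ dφ²`. -/
def heisGram (p : Fin 4 → ℝ) : Matrix (Fin 4) (Fin 4) ℝ :=
  p 3 • (Matrix.vecMulVec coframeSigma coframeSigma + Matrix.vecMulVec coframeRho coframeRho)
    + heisF 1 (p 3) • Matrix.vecMulVec (coframeZeta p) (coframeZeta p)
    + (1 / heisF 1 (p 3)) • Matrix.vecMulVec coframePhi coframePhi

theorem heisF_one_pos {t : ℝ} (ht : 0 < t) : 0 < heisF 1 t := by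
  have h1 : 1 + t + t ^ 2 / 2 ≤ Real.exp t := Real.quadratic_le_exp_of_nonneg ht.le
  have h2 : Real.exp t * Real.exp (-t) = 1 := by rw [← Real.exp_add]; simp
  have h3 : 0 < Real.exp (-t) := Real.exp_pos _
  have h4 : 0 < 1 - t + t ^ 2 / 2 := by nlinarith [sq_nonneg (t - 1)]
  have h5 : Real.exp (-t) < 1 - t + t ^ 2 / 2 := by
    have h6 : (1 + t + t ^ 2 / 2) * Real.exp (-t) ≤ 1 := by
      refine le_trans ?_ h2.le
      exact mul_le_mul_of_nonneg_right h1 h3.le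
    have h7 : 1 < (1 + t + t ^ 2 / 2) * (1 - t + t ^ 2 / 2) := by
      nlinarith [pow_pos ht 4]
    have h8 : 0 < 1 + t + t ^ 2 / 2 := by positivity
    exact lt_of_mul_lt_mul_left (h6.trans_lt h7) h8.le
  have h9 : heisF 1 t = 4 * (1 / t) * ((1 - t + t ^ 2 / 2) - Real.exp (-t)) := by
    simp [heisF, Finset.sum_range_succ, Nat.factorial]
    ring
  rw [h9]
  have : 0 < (1 - t + t ^ 2 / 2) - Real.exp (-t) := by linarith
  positivity

theorem heisF_contDiffOn (n : ℕ) : ContDiffOn ℝ ∞ (heisF n) (Set.Ioi 0) := by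
  unfold heisF
  refine ContDiffOn.mul (ContDiffOn.mul contDiffOn_const ?_) ?_
  · exact contDiffOn_const.div contDiffOn_id fun t ht => ne_of_gt ht
  · fun_prop

theorem heisGram_smooth (i j : Fin 4) :
    ContDiffOn ℝ ∞ (fun p => heisGram p i j) {p : Fin 4 → ℝ | 0 < p 3} := by
  have hF : ContDiffOn ℝ ∞ (fun p : Fin 4 → ℝ => heisF 1 (p 3)) {p | 0 < p 3} :=
    (heisF_contDiffOn 1).comp (by fun_prop) fun p hp => hp
  have hF' : ContDiffOn ℝ ∞ (fun p : Fin 4 → ℝ => 1 / heisF 1 (p 3)) {p | 0 < p 3} :=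
    contDiffOn_const.div hF fun p hp => (heisF_one_pos hp).ne'
  have hz : ∀ k, ContDiffOn ℝ ∞ (fun p : Fin 4 → ℝ => coframeZeta p k) {p | 0 < p 3} := by
    intro k
    fin_cases k <;> simp [coframeZeta] <;> fun_prop
  have h3 : ContDiffOn ℝ ∞ (fun p : Fin 4 → ℝ => p 3) {p | 0 < p 3} := by fun_prop
  simp only [heisGram, Matrix.add_apply, Matrix.smul_apply, Matrix.vecMulVec_apply, smul_eq_mul]
  exact ((h3.mul contDiffOn_const).add (hF.mul ((hz i).mul (hz j)))).add (hF'.mul contDiffOn_const)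

theorem heisGram_posDef {p : Fin 4 → ℝ} (hp : 0 < p 3) : (heisGram p).PosDef := by
  have hF := heisF_one_pos hp
  refine Matrix.PosDef.of_dotProduct_mulVec_pos ?_ ?_
  · ext i j
    simp [heisGram, Matrix.vecMulVec_apply, mul_comm]
  · intro v hv
    have key : star v ⬝ᵥ (heisGram p).mulVec v = p 3 * (v 0 ^ 2 + v 1 ^ 2)
        + heisF 1 (p 3) * (p 0 * v 1 - v 2) ^ 2 + (1 / heisF 1 (p 3)) * v 3 ^ 2 := by
      simp [heisGram, Matrix.mulVec, dotProduct, Fin.sum_univ_four,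
        coframeSigma, coframeRho, coframeZeta, coframePhi]
      ring
    rw [key]
    have e1 : 0 ≤ p 3 * (v 0 ^ 2 + v 1 ^ 2) := by positivity
    have e2 : 0 ≤ heisF 1 (p 3) * (p 0 * v 1 - v 2) ^ 2 := by positivity
    have e3 : 0 ≤ (1 / heisF 1 (p 3)) * v 3 ^ 2 := by positivity
    by_contra hle
    have f1 : p 3 * (v 0 ^ 2 + v 1 ^ 2) = 0 := by linarith
    have f2 : heisF 1 (p 3) * (p 0 * v 1 - v 2) ^ 2 = 0 := by linarith
    have f3 : (1 / heisF 1 (p 3)) * v 3 ^ 2 = 0 := by linarith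
    have g1 : v 0 ^ 2 + v 1 ^ 2 = 0 := (mul_eq_zero.1 f1).resolve_left hp.ne'
    have v0 : v 0 = 0 := by nlinarith [sq_nonneg (v 0), sq_nonneg (v 1)]
    have v1 : v 1 = 0 := by nlinarith [sq_nonneg (v 0), sq_nonneg (v 1)]
    have g2 : (p 0 * v 1 - v 2) ^ 2 = 0 := (mul_eq_zero.1 f2).resolve_left hF.ne'
    have v2 : v 2 = 0 := by
      have := pow_eq_zero_iff (two_ne_zero) |>.1 g2
      rw [v1] at this; linarith
    have v3 : v 3 = 0 := by
      have := (mul_eq_zero.1 f3).resolve_left (one_div_pos.2 hF).ne'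
      exact pow_eq_zero_iff (two_ne_zero) |>.1 this
    apply hv
    ext i
    fin_cases i <;> simp [v0, v1, v2, v3]

/-- The Heisenberg expanding gradient Kähler-Ricci soliton metric in complex dimension two, on
`M = H₃ × (0, ∞) = {(x, y, z, φ) | φ > 0}`. -/
def heisenbergSoliton : ChartMetric (Fin 4) where
  domain := {p | 0 < p 3}
  isOpen_domain := isOpen_lt continuous_const (continuous_apply 3)
  gram := heisGram
  smooth := heisGram_smooth
  posDef := fun _ hp => heisGram_posDef hp

end

/-!
For any momentum profile `F`, the metric `φ (σ² + ρ²) + F ζ² + F⁻¹ dφ²` has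
`⟨R(u, v) v, u⟩ = -(F'' / 2) a² - (F / φ²) b² + (F - φ F') / (4 φ²) (M - 4 a b)`, where `a` and `b`
are the values of `ζ ∧ dφ` and `φ σ ∧ ρ` on `(u, v)`, and `M ≥ 0` is the squared length of a mixed
part. The Gram determinant of `u`, `v` is `(a + b)² + M`.

The soliton profile is such that the three coefficients are moments of `e^{-φ s}` on `[0, 1]`:
`⟨R(u, v) v, u⟩ = -∫₀¹ (2 (s a - (1 - s) b)² + s (1 - s) M) e^{-φ s} ds`.
The integrand is nonnegative, so the curvature is negative. Dropping the factor `e^{-φ s} < 1`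
leaves the integral `(2 / 3) (a² - a b + b²) + M / 6`, which is at most `2 / 3` of the Gram
determinant because the Plücker relation gives `M + 4 a b ≥ 0`.

The plane `dφ = ζ = 0` has curvature `-F / φ²`, which tends to `-2 / 3` as `φ → 0` and to `0` as
`φ → ∞`, so both bounds are sharp.
-/

open scoped Matrix

section PartialDeriv

variable {ι : Type} [Fintype ι] [DecidableEq ι] {f g : (ι → ℝ) → ℝ} {p : ι → ℝ}

theorem partialDeriv_congr (h : f =ᶠ[nhds p] g) (k : ι) :
    partialDeriv f k p = partialDeriv g k p := by
  rw [partialDeriv, partialDeriv, h.fderiv_eq]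

theorem partialDeriv_eq_of_hasFDerivAt {L : (ι → ℝ) →L[ℝ] ℝ} (h : HasFDerivAt f L p) (k : ι) :
    partialDeriv f k p = L (Pi.single k 1) := by
  rw [partialDeriv, h.fderiv]

theorem partialDeriv_add (hf : DifferentiableAt ℝ f p) (hg : DifferentiableAt ℝ g p) (k : ι) :
    partialDeriv (fun q => f q + g q) k p = partialDeriv f k p + partialDeriv g k p :=
  partialDeriv_eq_of_hasFDerivAt (hf.hasFDerivAt.fun_add hg.hasFDerivAt) k

theorem partialDeriv_sub (hf : DifferentiableAt ℝ f p) (hg : DifferentiableAt ℝ g p) (k : ι) :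
    partialDeriv (fun q => f q - g q) k p = partialDeriv f k p - partialDeriv g k p :=
  partialDeriv_eq_of_hasFDerivAt (hf.hasFDerivAt.fun_sub hg.hasFDerivAt) k

theorem partialDeriv_mul (hf : DifferentiableAt ℝ f p) (hg : DifferentiableAt ℝ g p) (k : ι) :
    partialDeriv (fun q => f q * g q) k p =
      partialDeriv f k p * g p + f p * partialDeriv g k p := by
  rw [partialDeriv_eq_of_hasFDerivAt (hf.hasFDerivAt.fun_mul hg.hasFDerivAt) k]
  simp only [add_apply, smul_apply, smul_eq_mul, partialDeriv]
  ring

theorem partialDeriv_const_mul (hf : DifferentiableAt ℝ f p) (c : ℝ) (k : ι) :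
    partialDeriv (fun q => c * f q) k p = c * partialDeriv f k p :=
  partialDeriv_eq_of_hasFDerivAt (hf.hasFDerivAt.const_mul c) k

theorem partialDeriv_sum {κ : Type*} {s : Finset κ} {F : κ → (ι → ℝ) → ℝ}
    (hF : ∀ a ∈ s, DifferentiableAt ℝ (F a) p) (k : ι) :
    partialDeriv (fun q => ∑ a ∈ s, F a q) k p = ∑ a ∈ s, partialDeriv (F a) k p := by
  rw [partialDeriv_eq_of_hasFDerivAt (HasFDerivAt.fun_sum fun a ha => (hF a ha).hasFDerivAt) k,
    sum_apply]
  rfl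

theorem partialDeriv_comp_apply {φ : ℝ → ℝ} {i : ι} {φ' : ℝ} (hφ : HasDerivAt φ φ' (p i)) (k : ι) :
    partialDeriv (fun q => φ (q i)) k p = φ' * (Pi.single k 1 : ι → ℝ) i :=
  (partialDeriv_eq_of_hasFDerivAt (hφ.comp_hasFDerivAt p (hasFDerivAt_apply i p)) k).trans
    (by simp)

theorem differentiableAt_partialDeriv (hf : ContDiffAt ℝ 2 f p) (k : ι) :
    DifferentiableAt ℝ (partialDeriv f k) p :=
  ((hf.fderiv_right (m := 1) (by norm_num)).differentiableAt (by simp)).clm_apply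
    (differentiableAt_const _)

end PartialDeriv

section MatrixCalculus

variable {ι E : Type*} [Fintype ι] [DecidableEq ι] [NormedAddCommGroup E] [NormedSpace ℝ E]
  {A : E → Matrix ι ι ℝ} {x : E}

theorem differentiableAt_det (hA : ∀ i j, DifferentiableAt ℝ (fun y => A y i j) x) :
    DifferentiableAt ℝ (fun y => (A y).det) x := by
  simp only [Matrix.det_apply]
  exact DifferentiableAt.fun_sum fun σ _ =>
    (HasFDerivAt.finsetProd fun i _ => (hA (σ i) i).hasFDerivAt).differentiableAt.const_smul _

theorem differentiableAt_adjugate_apply (hA : ∀ i j, DifferentiableAt ℝ (fun y => A y i j) x)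
    (i j : ι) : DifferentiableAt ℝ (fun y => (A y).adjugate i j) x := by
  simp only [Matrix.adjugate_apply]
  refine differentiableAt_det fun k l => ?_
  by_cases hk : k = j
  · simp [hk, Matrix.updateRow_self]
  · simpa only [Matrix.updateRow_ne hk] using hA k l

theorem differentiableAt_inv_apply (hA : ∀ i j, DifferentiableAt ℝ (fun y => A y i j) x)
    (hdet : (A x).det ≠ 0) (i j : ι) : DifferentiableAt ℝ (fun y => (A y)⁻¹ i j) x := by
  simp only [Matrix.inv_def, Ring.inverse_eq_inv', Matrix.smul_apply, smul_eq_mul]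
  exact ((differentiableAt_det hA).fun_inv hdet).fun_mul (differentiableAt_adjugate_apply hA i j)

end MatrixCalculus

namespace ChartMetric

section General

variable {ι : Type} [Fintype ι] [DecidableEq ι] (g : ChartMetric ι) {p : ι → ℝ}

theorem inner_eq_toBilin' (p u v : ι → ℝ) :
    g.inner p u v = Matrix.toBilin' (g.gram p) u v := by
  rw [inner, Matrix.toBilin'_apply]
  exact Finset.sum_congr rfl fun i _ => Finset.sum_congr rfl fun j _ => by ring

theorem gram_symm (hp : p ∈ g.domain) (i j : ι) : g.gram p i j = g.gram p j i := by
  simpa using (g.posDef p hp).isHermitian.apply j i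

theorem gram_det_pos (hp : p ∈ g.domain) {u v : ι → ℝ} (h : LinearIndependent ℝ ![u, v]) :
    0 < g.inner p u u * g.inner p v v - g.inner p u v ^ 2 := by
  have hpos : ∀ w : ι → ℝ, w ≠ 0 → 0 < Matrix.toBilin' (g.gram p) w w := fun w hw => by
    simpa [Matrix.toBilin'_apply'] using (g.posDef p hp).dotProduct_mulVec_pos hw
  have hsymm : LinearMap.IsSymm (Matrix.toBilin' (g.gram p)) :=
    LinearMap.BilinForm.isSymm_iff.1 (Matrix.isSymm_toBilin'_iff_isSymm.2
      (Matrix.IsSymm.ext fun i j => g.gram_symm hp j i))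
  simpa only [inner_eq_toBilin', sub_pos] using
    (LinearMap.BilinForm.apply_sq_lt_iff_linearIndependent_of_symm _ hpos hsymm u v).2 h

theorem contDiffAt_gram (hp : p ∈ g.domain) (i j : ι) :
    ContDiffAt ℝ ∞ (fun q => g.gram q i j) p :=
  (g.smooth i j).contDiffAt (g.isOpen_domain.mem_nhds hp)

theorem differentiableAt_gram (hp : p ∈ g.domain) (i j : ι) :
    DifferentiableAt ℝ (fun q => g.gram q i j) p :=
  (g.contDiffAt_gram hp i j).differentiableAt (by simp)

theorem differentiableAt_partialDeriv_gram (hp : p ∈ g.domain) (i j k : ι) :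
    DifferentiableAt ℝ (partialDeriv (fun q => g.gram q i j) k) p :=
  differentiableAt_partialDeriv ((g.contDiffAt_gram hp i j).of_le (WithTop.coe_le_coe.2 le_top)) k

/-- The Christoffel symbol of the first kind `Γ_{m,ij} = ∑ l, g_{ml} Γ^l_{ij}`. -/
noncomputable def christoffelLower (m i j : ι) (p : ι → ℝ) : ℝ :=
  (1 / 2) * (partialDeriv (fun q => g.gram q j m) i p
    + partialDeriv (fun q => g.gram q i m) j p - partialDeriv (fun q => g.gram q i j) m p)

theorem christoffel_eq_sum (l i j : ι) (p : ι → ℝ) :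
    g.christoffel l i j p = ∑ m, (g.gram p)⁻¹ l m * g.christoffelLower m i j p := by
  simp only [christoffel, christoffelLower, Finset.mul_sum]
  exact Finset.sum_congr rfl fun m _ => by ring

theorem sum_gram_mul_christoffel (hp : p ∈ g.domain) (m i j : ι) :
    ∑ l, g.gram p m l * g.christoffel l i j p = g.christoffelLower m i j p := by
  have hdet : IsUnit (g.gram p).det := (g.posDef p hp).det_pos.ne'.isUnit
  have h := congrFun (Matrix.mulVec_mulVec (fun n => g.christoffelLower n i j p)
    (g.gram p) (g.gram p)⁻¹) m
  rw [Matrix.mul_nonsing_inv _ hdet, Matrix.one_mulVec] at h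
  simpa only [Matrix.mulVec, dotProduct, ← christoffel_eq_sum] using h

theorem partialDeriv_gram (hp : p ∈ g.domain) (i j k : ι) :
    partialDeriv (fun q => g.gram q i j) k p
      = g.christoffelLower i k j p + g.christoffelLower j k i p := by
  have hsymm (k i j : ι) :
      partialDeriv (fun q => g.gram q i j) k p = partialDeriv (fun q => g.gram q j i) k p :=
    partialDeriv_congr (by
      filter_upwards [g.isOpen_domain.mem_nhds hp] with q hq using g.gram_symm hq i j) k
  rw [christoffelLower, christoffelLower, hsymm k j i]
  ring

theorem differentiableAt_christoffelLower (hp : p ∈ g.domain) (m i j : ι) :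
    DifferentiableAt ℝ (g.christoffelLower m i j) p :=
  (((g.differentiableAt_partialDeriv_gram hp j m i).fun_add
    (g.differentiableAt_partialDeriv_gram hp i m j)).fun_sub
    (g.differentiableAt_partialDeriv_gram hp i j m)).const_mul _

theorem differentiableAt_christoffel (hp : p ∈ g.domain) (l i j : ι) :
    DifferentiableAt ℝ (g.christoffel l i j) p := by
  simp only [funext (g.christoffel_eq_sum l i j)]
  exact DifferentiableAt.fun_sum fun m _ =>
    (differentiableAt_inv_apply (g.differentiableAt_gram hp)
      (g.posDef p hp).det_pos.ne' l m).fun_mul (g.differentiableAt_christoffelLower hp m i j)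

theorem partialDeriv_christoffelLower (hp : p ∈ g.domain) (m i j k : ι) :
    partialDeriv (g.christoffelLower m i j) k p =
      ∑ l, (partialDeriv (fun q => g.gram q m l) k p * g.christoffel l i j p
        + g.gram p m l * partialDeriv (g.christoffel l i j) k p) := by
  have hlower : g.christoffelLower m i j =ᶠ[nhds p]
      fun q => ∑ l, g.gram q m l * g.christoffel l i j q := by
    filter_upwards [g.isOpen_domain.mem_nhds hp] with q hq
    exact (g.sum_gram_mul_christoffel hq m i j).symm
  have hgram (l : ι) := g.differentiableAt_gram hp m l
  have hchr (l : ι) := g.differentiableAt_christoffel hp l i j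
  rw [partialDeriv_congr hlower, partialDeriv_sum fun l _ => (hgram l).fun_mul (hchr l)]
  exact Finset.sum_congr rfl fun l _ => partialDeriv_mul (hgram l) (hchr l) k

/-- The component `R_{lkij} = ∑ m, g_{lm} R^m_{kij}` of the curvature tensor with its upper index
lowered. -/
noncomputable def riemannLower (l k i j : ι) (p : ι → ℝ) : ℝ :=
  ∑ m, g.gram p l m * g.riemann m k i j p

theorem inner_curvature (hp : p ∈ g.domain) (u v w z : ι → ℝ) :
    g.inner p (g.curvature p u v w) z =
      ∑ l, ∑ k, ∑ i, ∑ j, g.riemannLower l k i j p * z l * w k * u i * v j := by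
  simp only [inner, curvature, riemannLower, Finset.mul_sum, Finset.sum_mul]
  rw [Finset.sum_comm]
  refine Finset.sum_congr rfl fun l _ => ?_
  rw [Finset.sum_comm]
  refine Finset.sum_congr rfl fun k _ => ?_
  rw [Finset.sum_comm]
  refine Finset.sum_congr rfl fun i _ => ?_
  rw [Finset.sum_comm]
  refine Finset.sum_congr rfl fun j _ => Finset.sum_congr rfl fun m _ => ?_
  rw [g.gram_symm hp m l]
  ring

theorem riemannLower_eq (hp : p ∈ g.domain) (l k i j : ι) :
    g.riemannLower l k i j p =
      partialDeriv (g.christoffelLower l j k) i p - partialDeriv (g.christoffelLower l i k) j p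
        + ∑ m, (g.christoffelLower m j l p * g.christoffel m i k p
          - g.christoffelLower m i l p * g.christoffel m j k p) := by
  have hquad (i j : ι) : ∑ m, g.gram p l m * ∑ n, g.christoffel m i n p * g.christoffel n j k p
      = ∑ n, g.christoffelLower l i n p * g.christoffel n j k p := by
    simp only [Finset.mul_sum, ← g.sum_gram_mul_christoffel hp, Finset.sum_mul, ← mul_assoc]
    exact Finset.sum_comm
  have hsplit : g.riemannLower l k i j p =
      ∑ m, g.gram p l m * partialDeriv (g.christoffel m j k) i p
        - ∑ m, g.gram p l m * partialDeriv (g.christoffel m i k) j p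
        + (∑ n, g.christoffelLower l i n p * g.christoffel n j k p
          - ∑ n, g.christoffelLower l j n p * g.christoffel n i k p) := by
    simp only [riemannLower, riemann, ← hquad, ← Finset.sum_sub_distrib, ← Finset.sum_add_distrib,
      ← mul_sub, ← mul_add]
  rw [hsplit, g.partialDeriv_christoffelLower hp, g.partialDeriv_christoffelLower hp]
  simp only [g.partialDeriv_gram hp, add_mul, Finset.sum_add_distrib, Finset.sum_sub_distrib]
  ring

theorem partialDeriv_christoffelLower_eq (hp : p ∈ g.domain) (m i j k : ι) :
    partialDeriv (g.christoffelLower m i j) k p = (1 / 2) *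
      (partialDeriv (partialDeriv (fun q => g.gram q j m) i) k p
        + partialDeriv (partialDeriv (fun q => g.gram q i m) j) k p
        - partialDeriv (partialDeriv (fun q => g.gram q i j) m) k p) := by
  have hd := g.differentiableAt_partialDeriv_gram hp
  unfold christoffelLower
  rw [partialDeriv_const_mul (((hd j m i).fun_add (hd i m j)).fun_sub (hd i j m)),
    partialDeriv_sub ((hd j m i).fun_add (hd i m j)) (hd i j m),
    partialDeriv_add (hd j m i) (hd i m j)]

end General

end ChartMetric

section Coframe

theorem coframeZeta_apply (q : Fin 4 → ℝ) (i : Fin 4) :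
    coframeZeta q i = coframeRho i * q 0 + coframeZeta 0 i := by
  fin_cases i <;> simp [coframeZeta, coframeRho]

theorem differentiableAt_coframeZeta (p : Fin 4 → ℝ) (i : Fin 4) :
    DifferentiableAt ℝ (fun q => coframeZeta q i) p := by
  rw [funext fun q => coframeZeta_apply q i]
  fun_prop

theorem partialDeriv_coframeZeta (p : Fin 4 → ℝ) (i k : Fin 4) :
    partialDeriv (fun q => coframeZeta q i) k p = coframeSigma k * coframeRho i := by
  have haffine : HasDerivAt (fun x => coframeRho i * x + coframeZeta 0 i) (coframeRho i) (p 0) := by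
    simpa using ((hasDerivAt_id' (p 0)).const_mul (coframeRho i)).add_const (coframeZeta 0 i)
  rw [funext fun q => coframeZeta_apply q i, partialDeriv_comp_apply haffine]
  fin_cases k <;> simp [coframeSigma]

theorem partialDeriv_comp_apply_three {f : ℝ → ℝ} {f' : ℝ} {p : Fin 4 → ℝ}
    (hf : HasDerivAt f f' (p 3)) (k : Fin 4) :
    partialDeriv (fun q => f (q 3)) k p = coframePhi k * f' := by
  rw [partialDeriv_comp_apply hf]
  fin_cases k <;> simp [coframePhi]

theorem partialDeriv_add_mul_coframeZeta {a f h : ℝ → ℝ} {a' f' h' : ℝ} {p : Fin 4 → ℝ}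
    (ha : HasDerivAt a a' (p 3)) (hf : HasDerivAt f f' (p 3)) (hh : HasDerivAt h h' (p 3))
    (i j k : Fin 4) :
    partialDeriv (fun q => a (q 3) + f (q 3) * (coframeZeta q i * coframeZeta q j)
        + h (q 3) * (coframeRho i * coframeZeta q j + coframeZeta q i * coframeRho j)) k p =
      coframePhi k * (a' + f' * (coframeZeta p i * coframeZeta p j)
        + h' * (coframeRho i * coframeZeta p j + coframeZeta p i * coframeRho j))
      + coframeSigma k *
        (f (p 3) * (coframeRho i * coframeZeta p j + coframeZeta p i * coframeRho j)
          + 2 * h (p 3) * (coframeRho i * coframeRho j)) := by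
  have hcomp {φ : ℝ → ℝ} {φ' : ℝ} (hφ : HasDerivAt φ φ' (p 3)) :
      DifferentiableAt ℝ (fun q : Fin 4 → ℝ => φ (q 3)) p :=
    hφ.differentiableAt.fun_comp' p (differentiableAt_apply 3 p)
  have hζ := differentiableAt_coframeZeta p
  have hρ (c : ℝ) (i : Fin 4) : DifferentiableAt ℝ (fun q => c * coframeZeta q i) p :=
    (hζ i).const_mul c
  have hff := (hcomp hf).fun_mul ((hζ i).fun_mul (hζ j))
  simp only [mul_comm _ (coframeRho j)]
  rw [partialDeriv_add ((hcomp ha).fun_add hff)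
      ((hcomp hh).fun_mul ((hρ _ j).fun_add (hρ _ i))),
    partialDeriv_add (hcomp ha) hff, partialDeriv_mul (hcomp hf) ((hζ i).fun_mul (hζ j)),
    partialDeriv_mul (hcomp hh) ((hρ _ j).fun_add (hρ _ i)), partialDeriv_add (hρ _ j) (hρ _ i),
    partialDeriv_mul (hζ i) (hζ j), partialDeriv_const_mul (hζ i), partialDeriv_const_mul (hζ j),
    partialDeriv_comp_apply_three ha, partialDeriv_comp_apply_three hf,
    partialDeriv_comp_apply_three hh, partialDeriv_coframeZeta, partialDeriv_coframeZeta]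
  ring

end Coframe

section InverseGram

variable {ι : Type*} [Fintype ι] [DecidableEq ι]

theorem dotProduct_inv_diagonal_congruence_mulVec {Θ : Matrix ι ι ℝ} (hΘ : IsUnit Θ.det)
    {h : ι → ℝ} (hh : ∀ a, h a ≠ 0) (c d : ι → ℝ) :
    (c ᵥ* Θ) ⬝ᵥ ((Θᵀ * Matrix.diagonal h * Θ)⁻¹ *ᵥ (d ᵥ* Θ)) = ∑ a, c a * d a / h a := by
  have hdiag : IsUnit (Matrix.diagonal h).det := by
    rw [Matrix.det_diagonal]
    exact (Finset.prod_ne_zero_iff.2 fun a _ => hh a).isUnit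
  have hinv : (Θᵀ * Matrix.diagonal h * Θ)⁻¹ *ᵥ (d ᵥ* Θ)
      = Θ⁻¹ *ᵥ fun a => d a / h a := by
    have hsolve : (Θᵀ * Matrix.diagonal h * Θ) *ᵥ (Θ⁻¹ *ᵥ fun a => d a / h a) = d ᵥ* Θ := by
      rw [Matrix.mulVec_mulVec, Matrix.mul_assoc, Matrix.mul_nonsing_inv _ hΘ,
        Matrix.mul_one, ← Matrix.mulVec_mulVec, ← Matrix.mulVec_transpose]
      congr 1
      ext a
      simp [Matrix.mulVec_diagonal, mul_div_cancel₀, hh]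
    rw [← hsolve, Matrix.mulVec_mulVec, Matrix.nonsing_inv_mul, Matrix.one_mulVec]
    simpa only [Matrix.det_mul, Matrix.det_transpose] using (hΘ.mul hdiag).mul hΘ
  rw [hinv, ← Matrix.dotProduct_mulVec, Matrix.mulVec_mulVec, Matrix.mul_nonsing_inv _ hΘ,
    Matrix.one_mulVec]
  simp only [dotProduct, mul_div_assoc]

end InverseGram

/-- The coframe `(σ, ρ, ζ, dφ)` at `p`, as the matrix whose rows are the four 1-forms. -/
noncomputable def coframe (p : Fin 4 → ℝ) : Matrix (Fin 4) (Fin 4) ℝ :=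
  Matrix.of ![coframeSigma, coframeRho, coframeZeta p, coframePhi]

/-- The 2-form `α ∧ β`, as the antisymmetric matrix of its components. -/
noncomputable def wedge {ι : Type*} (α β : ι → ℝ) : Matrix ι ι ℝ :=
  Matrix.vecMulVec α β - Matrix.vecMulVec β α

theorem dotProduct_vecMulVec_mulVec {ι : Type*} [Fintype ι] (α β u v : ι → ℝ) :
    u ⬝ᵥ Matrix.vecMulVec α β *ᵥ v = (α ⬝ᵥ u) * (β ⬝ᵥ v) := by
  rw [Matrix.vecMulVec_mulVec, op_smul_eq_smul, dotProduct_smul, dotProduct_comm u, smul_eq_mul,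
    mul_comm]

theorem dotProduct_wedge_mulVec {ι : Type*} [Fintype ι] (α β u v : ι → ℝ) :
    u ⬝ᵥ wedge α β *ᵥ v = (α ⬝ᵥ u) * (β ⬝ᵥ v) - (β ⬝ᵥ u) * (α ⬝ᵥ v) := by
  simp only [wedge, Matrix.sub_mulVec, dotProduct_sub, dotProduct_vecMulVec_mulVec]

theorem sum_mul_mul_eq_dotProduct_mulVec {ι : Type*} [Fintype ι] (A B : Matrix ι ι ℝ)
    (u v : ι → ℝ) :
    ∑ l, ∑ k, ∑ i, ∑ j, A l k * B i j * u l * v k * u i * v j =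
      (u ⬝ᵥ A *ᵥ v) * (u ⬝ᵥ B *ᵥ v) := by
  rw [mul_comm]
  simp only [dotProduct, Matrix.mulVec, Finset.mul_sum, Finset.sum_mul]
  exact Finset.sum_congr rfl fun l _ => Finset.sum_congr rfl fun k _ =>
    Finset.sum_congr rfl fun i _ => Finset.sum_congr rfl fun j _ => by ring

theorem isUnit_det_coframe (p : Fin 4 → ℝ) : IsUnit (coframe p).det := by
  simp [coframe, coframeSigma, coframeRho, coframeZeta, coframePhi, Matrix.det_succ_row_zero,
    Fin.sum_univ_succ, Fin.succAbove]

/-- The components in the coframe of the 1-form `m ↦ Γ_{m,ij}`, for the metric with momentum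
profile `F`. -/
noncomputable def christoffelCoframe (F : ℝ → ℝ) (p : Fin 4 → ℝ) (i j : Fin 4) : Fin 4 → ℝ :=
  ![(coframePhi i * coframeSigma j + coframePhi j * coframeSigma i
      - F (p 3) * (coframeRho i * coframeZeta p j + coframeZeta p i * coframeRho j)) / 2,
    (coframePhi i * coframeRho j + coframePhi j * coframeRho i
      + F (p 3) * (coframeSigma i * coframeZeta p j + coframeZeta p i * coframeSigma j)) / 2,
    (deriv F (p 3) * (coframePhi i * coframeZeta p j + coframePhi j * coframeZeta p i)
      + F (p 3) * (coframeSigma i * coframeRho j + coframeRho i * coframeSigma j)) / 2,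
    (-(deriv F (p 3) / F (p 3) ^ 2) * (coframePhi i * coframePhi j)
      - coframeSigma i * coframeSigma j - coframeRho i * coframeRho j
      - deriv F (p 3) * (coframeZeta p i * coframeZeta p j)) / 2]

/-- The 2-form `ζ ∧ dφ`: minus the fibre part of the Kähler form `d(φ ζ) = φ σ ∧ ρ - ζ ∧ dφ`. -/
noncomputable def fiberForm (p : Fin 4 → ℝ) : Matrix (Fin 4) (Fin 4) ℝ :=
  wedge (coframeZeta p) coframePhi

/-- The 2-form `φ σ ∧ ρ`: the base part of the Kähler form `d(φ ζ) = φ σ ∧ ρ - ζ ∧ dφ`. -/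
noncomputable def baseForm (p : Fin 4 → ℝ) : Matrix (Fin 4) (Fin 4) ℝ :=
  p 3 • wedge coframeSigma coframeRho

/-- The real part of the complex 2-form `(σ + iρ) ∧ (ζ + i dφ / F)`, which is of type `(1, 1)` for
the complex structure whose `(1, 0)`-forms are spanned by `σ + iρ` and `ζ - i dφ / F`. -/
noncomputable def mixedFormRe (F : ℝ → ℝ) (p : Fin 4 → ℝ) : Matrix (Fin 4) (Fin 4) ℝ :=
  wedge coframeSigma (coframeZeta p) - (1 / F (p 3)) • wedge coframeRho coframePhi

/-- The imaginary part of `(σ + iρ) ∧ (ζ + i dφ / F)`, see `mixedFormRe`. -/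
noncomputable def mixedFormIm (F : ℝ → ℝ) (p : Fin 4 → ℝ) : Matrix (Fin 4) (Fin 4) ℝ :=
  wedge coframeRho (coframeZeta p) + (1 / F (p 3)) • wedge coframeSigma coframePhi

theorem dotProduct_fiberForm_mulVec (p u v : Fin 4 → ℝ) : u ⬝ᵥ fiberForm p *ᵥ v =
    (coframeZeta p ⬝ᵥ u) * (coframePhi ⬝ᵥ v) - (coframePhi ⬝ᵥ u) * (coframeZeta p ⬝ᵥ v) :=
  dotProduct_wedge_mulVec ..

theorem dotProduct_baseForm_mulVec (p u v : Fin 4 → ℝ) : u ⬝ᵥ baseForm p *ᵥ v =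
    p 3 *
      ((coframeSigma ⬝ᵥ u) * (coframeRho ⬝ᵥ v) - (coframeRho ⬝ᵥ u) * (coframeSigma ⬝ᵥ v)) := by
  rw [baseForm, Matrix.smul_mulVec, dotProduct_smul, dotProduct_wedge_mulVec, smul_eq_mul]

theorem dotProduct_mixedFormRe_mulVec (F : ℝ → ℝ) (p u v : Fin 4 → ℝ) :
    u ⬝ᵥ mixedFormRe F p *ᵥ v =
      (coframeSigma ⬝ᵥ u) * (coframeZeta p ⬝ᵥ v) - (coframeZeta p ⬝ᵥ u) * (coframeSigma ⬝ᵥ v)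
        - 1 / F (p 3) *
          ((coframeRho ⬝ᵥ u) * (coframePhi ⬝ᵥ v) - (coframePhi ⬝ᵥ u) * (coframeRho ⬝ᵥ v)) := by
  rw [mixedFormRe, Matrix.sub_mulVec, Matrix.smul_mulVec, dotProduct_sub, dotProduct_smul,
    dotProduct_wedge_mulVec, dotProduct_wedge_mulVec, smul_eq_mul]

theorem dotProduct_mixedFormIm_mulVec (F : ℝ → ℝ) (p u v : Fin 4 → ℝ) :
    u ⬝ᵥ mixedFormIm F p *ᵥ v =
      (coframeRho ⬝ᵥ u) * (coframeZeta p ⬝ᵥ v) - (coframeZeta p ⬝ᵥ u) * (coframeRho ⬝ᵥ v)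
        + 1 / F (p 3) *
          ((coframeSigma ⬝ᵥ u) * (coframePhi ⬝ᵥ v) - (coframePhi ⬝ᵥ u) * (coframeSigma ⬝ᵥ v)) := by
  rw [mixedFormIm, Matrix.add_mulVec, Matrix.smul_mulVec, dotProduct_add, dotProduct_smul,
    dotProduct_wedge_mulVec, dotProduct_wedge_mulVec, smul_eq_mul]

/-- The squared length of the component of `u ∧ v` along the 2-forms `mixedFormRe` and
`mixedFormIm`, scaled so that it enters the Gram determinant of `u`, `v` with coefficient one. -/
noncomputable def mixedNormSq (F : ℝ → ℝ) (p u v : Fin 4 → ℝ) : ℝ :=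
  p 3 * F (p 3) * ((u ⬝ᵥ mixedFormRe F p *ᵥ v) ^ 2 + (u ⬝ᵥ mixedFormIm F p *ᵥ v) ^ 2)

namespace ChartMetric

/-- The Calabi ansatz for the momentum profile `F`, as in the soliton metric, where `F = heisF 1`:
the metric is `φ (σ² + ρ²) + F(φ) ζ² + F(φ)⁻¹ dφ²` on its domain. -/
def HasMomentumProfile (g : ChartMetric (Fin 4)) (F : ℝ → ℝ) : Prop :=
  ∀ p ∈ g.domain, g.gram p =
    p 3 • (Matrix.vecMulVec coframeSigma coframeSigma + Matrix.vecMulVec coframeRho coframeRho)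
      + F (p 3) • Matrix.vecMulVec (coframeZeta p) (coframeZeta p)
      + (1 / F (p 3)) • Matrix.vecMulVec coframePhi coframePhi

namespace HasMomentumProfile

variable {g : ChartMetric (Fin 4)} {F : ℝ → ℝ} (hg : g.HasMomentumProfile F) {p : Fin 4 → ℝ}
  (hp : p ∈ g.domain)

include hg hp

theorem gram_apply (i j : Fin 4) : g.gram p i j =
    p 3 * (coframeSigma i * coframeSigma j + coframeRho i * coframeRho j)
      + F (p 3) * (coframeZeta p i * coframeZeta p j)
      + 1 / F (p 3) * (coframePhi i * coframePhi j) := by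
  simp [hg p hp, Matrix.vecMulVec_apply, mul_add]

theorem coord_pos : 0 < p 3 := by
  simpa [hg.gram_apply hp, coframeSigma, coframeRho, coframeZeta, coframePhi] using
    (g.posDef p hp).diag_pos (i := 0)

theorem profile_pos : 0 < F (p 3) := by
  simpa [hg.gram_apply hp, coframeSigma, coframeRho, coframeZeta, coframePhi] using
    (g.posDef p hp).diag_pos (i := 2)

theorem contDiffAt_profile : ContDiffAt ℝ ∞ F (p 3) := by
  have hline : ContDiff ℝ ∞ fun t : ℝ => Function.update p 3 t := contDiff_update ∞ p 3
  have hmem : ∀ᶠ t in nhds (p 3), Function.update p 3 t ∈ g.domain :=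
    hline.continuous.continuousAt.eventually_mem
      (by simpa using g.isOpen_domain.mem_nhds hp)
  refine ContDiffAt.congr_of_eventuallyEq (f := fun t => g.gram (Function.update p 3 t) 2 2)
    (ContDiffAt.comp (p 3) (g := fun q => g.gram q 2 2)
      (by simpa using g.contDiffAt_gram hp 2 2) hline.contDiffAt) ?_
  filter_upwards [hmem] with t ht
  simp [hg.gram_apply ht, coframeSigma, coframeRho, coframeZeta, coframePhi]

theorem hasDerivAt_profile : HasDerivAt F (deriv F (p 3)) (p 3) :=
  ((hg.contDiffAt_profile hp).differentiableAt (by simp)).hasDerivAt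

theorem hasDerivAt_deriv_profile : HasDerivAt (deriv F) (deriv (deriv F) (p 3)) (p 3) :=
  (((hg.contDiffAt_profile hp).of_le (m := 2) (WithTop.coe_le_coe.2 le_top)).derivWithin
    (m := 1) (by norm_num)).differentiableAt (by simp) |>.hasDerivAt

theorem hasDerivAt_one_div_profile :
    HasDerivAt (fun t => 1 / F t) (-deriv F (p 3) / F (p 3) ^ 2) (p 3) := by
  simpa only [one_div] using (hg.hasDerivAt_profile hp).fun_inv (hg.profile_pos hp).ne'

theorem partialDeriv_gram (i j k : Fin 4) :
    partialDeriv (fun q => g.gram q i j) k p =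
      coframePhi k * (coframeSigma i * coframeSigma j + coframeRho i * coframeRho j
        + deriv F (p 3) * (coframeZeta p i * coframeZeta p j)
        - deriv F (p 3) / F (p 3) ^ 2 * (coframePhi i * coframePhi j))
      + coframeSigma k *
        (F (p 3) * (coframeRho i * coframeZeta p j + coframeZeta p i * coframeRho j)) := by
  have hconst := ((hasDerivAt_id' (p 3)).mul_const
    (coframeSigma i * coframeSigma j + coframeRho i * coframeRho j)).fun_add
    ((hg.hasDerivAt_one_div_profile hp).mul_const (coframePhi i * coframePhi j))
  refine (partialDeriv_congr ?_ k).trans ((partialDeriv_add_mul_coframeZeta hconst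
    (hg.hasDerivAt_profile hp) (hasDerivAt_const (p 3) 0) i j k).trans (by ring))
  filter_upwards [g.isOpen_domain.mem_nhds hp] with q hq
  rw [hg.gram_apply hq]
  ring

theorem partialDeriv_partialDeriv_gram (i j k m : Fin 4) :
    partialDeriv (partialDeriv (fun q => g.gram q i j) k) m p =
      coframePhi k *
        (coframePhi m * (deriv (deriv F) (p 3) * (coframeZeta p i * coframeZeta p j)
            - deriv (fun t => deriv F t / F t ^ 2) (p 3) * (coframePhi i * coframePhi j))
          + coframeSigma m * (deriv F (p 3) *
            (coframeRho i * coframeZeta p j + coframeZeta p i * coframeRho j)))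
      + coframeSigma k *
        (coframePhi m * (deriv F (p 3) *
            (coframeRho i * coframeZeta p j + coframeZeta p i * coframeRho j))
          + coframeSigma m * (2 * F (p 3) * (coframeRho i * coframeRho j))) := by
  have hF' := hg.hasDerivAt_deriv_profile hp
  have hF := hg.hasDerivAt_profile hp
  have he := (hF'.fun_div (hF.fun_pow 2)
    (pow_ne_zero 2 (hg.profile_pos hp).ne')).differentiableAt.hasDerivAt
  have hconst := (((he.mul_const (coframePhi i * coframePhi j)).const_sub
    (coframeSigma i * coframeSigma j + coframeRho i * coframeRho j)).const_mul (coframePhi k))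
  refine (partialDeriv_congr ?_ m).trans ((partialDeriv_add_mul_coframeZeta hconst
    (hF'.const_mul (coframePhi k)) (hF.const_mul (coframeSigma k)) i j m).trans (by ring))
  filter_upwards [g.isOpen_domain.mem_nhds hp] with q hq
  rw [hg.partialDeriv_gram hq]
  ring

theorem christoffelLower_eq (m i j : Fin 4) :
    g.christoffelLower m i j p = (christoffelCoframe F p i j ᵥ* coframe p) m := by
  rw [christoffelLower, hg.partialDeriv_gram hp, hg.partialDeriv_gram hp, hg.partialDeriv_gram hp]
  simp only [christoffelCoframe, coframe, Matrix.vecMul, dotProduct, Fin.sum_univ_four,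
    Matrix.of_apply, Matrix.cons_val]
  ring

theorem gram_eq_congruence : g.gram p =
    (coframe p)ᵀ * Matrix.diagonal ![p 3, p 3, F (p 3), 1 / F (p 3)] * coframe p := by
  ext i j
  rw [hg.gram_apply hp, Matrix.mul_apply]
  simp only [Matrix.mul_diagonal, Matrix.transpose_apply, coframe, Matrix.of_apply,
    Fin.sum_univ_four, Matrix.cons_val]
  ring

theorem sum_christoffelLower_mul_christoffel (i j k l : Fin 4) :
    ∑ m, g.christoffelLower m i j p * g.christoffel m k l p =
      ∑ a, christoffelCoframe F p i j a * christoffelCoframe F p k l a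
        / (![p 3, p 3, F (p 3), 1 / F (p 3)] : Fin 4 → ℝ) a := by
  have hφ := (hg.coord_pos hp).ne'
  have hF := (hg.profile_pos hp).ne'
  rw [← dotProduct_inv_diagonal_congruence_mulVec (isUnit_det_coframe p)
    (by simp [Fin.forall_fin_succ, hφ, hF]), ← hg.gram_eq_congruence hp]
  simp only [dotProduct, Matrix.mulVec, ← hg.christoffelLower_eq hp, ← christoffel_eq_sum]

theorem riemannLower_eq (l k i j : Fin 4) :
    g.riemannLower l k i j p =
      -(deriv (deriv F) (p 3) / 2) * (fiberForm p l k * fiberForm p i j)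
      - F (p 3) / p 3 ^ 2 * (baseForm p l k * baseForm p i j)
      + (F (p 3) - p 3 * deriv F (p 3)) / (4 * p 3 ^ 2) *
        (-2 * (fiberForm p l k * baseForm p i j + baseForm p l k * fiberForm p i j)
          + p 3 * F (p 3) * (mixedFormRe F p l k * mixedFormRe F p i j
            + mixedFormIm F p l k * mixedFormIm F p i j)) := by
  have hφ := (hg.coord_pos hp).ne'
  have hF := (hg.profile_pos hp).ne'
  rw [g.riemannLower_eq hp, Finset.sum_sub_distrib, hg.sum_christoffelLower_mul_christoffel hp,
    hg.sum_christoffelLower_mul_christoffel hp, g.partialDeriv_christoffelLower_eq hp,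
    g.partialDeriv_christoffelLower_eq hp]
  simp only [hg.partialDeriv_partialDeriv_gram hp, christoffelCoframe, Fin.sum_univ_four,
    Matrix.cons_val, fiberForm, baseForm, mixedFormRe, mixedFormIm, wedge, Matrix.sub_apply,
    Matrix.add_apply, Matrix.smul_apply, Matrix.vecMulVec_apply, smul_eq_mul]
  -- The derivative of `F' / F ^ 2` only multiplies `dφ ⊗ dφ ⊗ dφ ⊗ dφ`, which cancels on
  -- antisymmetrization.
  field_simp
  ring

theorem inner_eq (u v : Fin 4 → ℝ) : g.inner p u v =
    p 3 * ((coframeSigma ⬝ᵥ u) * (coframeSigma ⬝ᵥ v) + (coframeRho ⬝ᵥ u) * (coframeRho ⬝ᵥ v))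
      + F (p 3) * ((coframeZeta p ⬝ᵥ u) * (coframeZeta p ⬝ᵥ v))
      + 1 / F (p 3) * ((coframePhi ⬝ᵥ u) * (coframePhi ⬝ᵥ v)) := by
  rw [inner_eq_toBilin', Matrix.toBilin'_apply', hg p hp]
  simp only [Matrix.add_mulVec, Matrix.smul_mulVec, dotProduct_add, dotProduct_smul, smul_eq_mul,
    dotProduct_vecMulVec_mulVec]

theorem gram_det_eq (u v : Fin 4 → ℝ) :
    g.inner p u u * g.inner p v v - g.inner p u v ^ 2 =
      (u ⬝ᵥ fiberForm p *ᵥ v + u ⬝ᵥ baseForm p *ᵥ v) ^ 2 + mixedNormSq F p u v := by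
  have hF := (hg.profile_pos hp).ne'
  simp only [hg.inner_eq hp, mixedNormSq, dotProduct_fiberForm_mulVec,
    dotProduct_baseForm_mulVec, dotProduct_mixedFormRe_mulVec, dotProduct_mixedFormIm_mulVec]
  field_simp
  ring

theorem mixedNormSq_nonneg (u v : Fin 4 → ℝ) : 0 ≤ mixedNormSq F p u v := by
  have hφ := hg.coord_pos hp
  have hF := hg.profile_pos hp
  rw [mixedNormSq]
  positivity

theorem mixedNormSq_add_nonneg (u v : Fin 4 → ℝ) :
    0 ≤ mixedNormSq F p u v + 4 * (u ⬝ᵥ fiberForm p *ᵥ v) * (u ⬝ᵥ baseForm p *ᵥ v) := by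
  have hφ := hg.coord_pos hp
  have hF := hg.profile_pos hp
  -- By the Plücker relation, this is the squared length of the component of `u ∧ v` along the
  -- `(2, 0)`-form `(σ + iρ) ∧ (ζ - i dφ / F)`.
  have hplucker : mixedNormSq F p u v + 4 * (u ⬝ᵥ fiberForm p *ᵥ v) * (u ⬝ᵥ baseForm p *ᵥ v) =
      p 3 * F (p 3) *
        (((coframeSigma ⬝ᵥ u) * (coframeZeta p ⬝ᵥ v) - (coframeZeta p ⬝ᵥ u) * (coframeSigma ⬝ᵥ v)
            + ((coframeRho ⬝ᵥ u) * (coframePhi ⬝ᵥ v) - (coframePhi ⬝ᵥ u) * (coframeRho ⬝ᵥ v))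
              / F (p 3)) ^ 2
          + ((coframeRho ⬝ᵥ u) * (coframeZeta p ⬝ᵥ v) - (coframeZeta p ⬝ᵥ u) * (coframeRho ⬝ᵥ v)
            - ((coframeSigma ⬝ᵥ u) * (coframePhi ⬝ᵥ v) - (coframePhi ⬝ᵥ u) * (coframeSigma ⬝ᵥ v))
              / F (p 3)) ^ 2) := by
    simp only [mixedNormSq, dotProduct_fiberForm_mulVec, dotProduct_baseForm_mulVec,
      dotProduct_mixedFormRe_mulVec, dotProduct_mixedFormIm_mulVec]
    field_simp
    ring
  rw [hplucker]
  positivity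

theorem inner_curvature_eq (u v : Fin 4 → ℝ) :
    g.inner p (g.curvature p u v v) u =
      -(deriv (deriv F) (p 3) / 2) * (u ⬝ᵥ fiberForm p *ᵥ v) ^ 2
      - F (p 3) / p 3 ^ 2 * (u ⬝ᵥ baseForm p *ᵥ v) ^ 2
      + (F (p 3) - p 3 * deriv F (p 3)) / (4 * p 3 ^ 2) *
        (mixedNormSq F p u v - 4 * (u ⬝ᵥ fiberForm p *ᵥ v) * (u ⬝ᵥ baseForm p *ᵥ v)) := by
  rw [g.inner_curvature hp]
  simp only [hg.riemannLower_eq hp, add_mul, sub_mul, mul_add, mul_assoc _ (_ * _),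
    Finset.sum_add_distrib, Finset.sum_sub_distrib, ← Finset.mul_sum]
  simp only [← mul_assoc, sum_mul_mul_eq_dotProduct_mulVec]
  rw [mixedNormSq]
  ring

theorem sec_horizontal : g.sec p ![1, 0, 0, 0] ![0, 1, p 0, 0] = -(F (p 3) / p 3 ^ 2) := by
  have hφ := (hg.coord_pos hp).ne'
  rw [sec, hg.inner_curvature_eq hp, hg.gram_det_eq hp]
  simp only [mixedNormSq, dotProduct_fiberForm_mulVec, dotProduct_baseForm_mulVec,
    dotProduct_mixedFormRe_mulVec, dotProduct_mixedFormIm_mulVec]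
  simp only [coframeSigma, coframeRho, coframeZeta, coframePhi, dotProduct, Fin.sum_univ_four,
    Matrix.cons_val]
  field_simp
  ring

end HasMomentumProfile

end ChartMetric

section CurvatureKernel

/-- Against the weight `e^{-φ s}` on `[0, 1]`, this quadratic polynomial in `s` integrates to minus
the curvature of a plane on which the fibre and base forms take the values `a` and `b` and which has
mixed part `M`. -/
def curvatureKernel (a b M s : ℝ) : ℝ :=
  2 * (s * a - (1 - s) * b) ^ 2 + s * (1 - s) * M

variable {a b M t : ℝ}

theorem continuous_curvatureKernel (a b M : ℝ) : Continuous (curvatureKernel a b M) := by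
  unfold curvatureKernel
  fun_prop

theorem curvatureKernel_nonneg {s : ℝ} (a b : ℝ) (hM : 0 ≤ M) (hs : s ∈ Set.Icc (0 : ℝ) 1) :
    0 ≤ curvatureKernel a b M s :=
  add_nonneg (by positivity) (mul_nonneg (mul_nonneg hs.1 (sub_nonneg.2 hs.2)) hM)

theorem exists_curvatureKernel_pos (h : 0 < (a + b) ^ 2 + M) :
    ∃ s ∈ Set.Ioc (0 : ℝ) 1, 0 < curvatureKernel a b M s := by
  rcases eq_or_ne a 0 with rfl | ha
  · refine ⟨1 / 2, by norm_num, ?_⟩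
    rw [curvatureKernel]
    nlinarith
  · refine ⟨1, by norm_num, ?_⟩
    rw [curvatureKernel, one_mul, sub_self, zero_mul, sub_zero, mul_zero, zero_mul, add_zero]
    positivity

theorem integral_curvatureKernel (a b M : ℝ) :
    ∫ s in (0 : ℝ)..1, curvatureKernel a b M s = 2 / 3 * (a ^ 2 - a * b + b ^ 2) + M / 6 := by
  have hprim : ∀ s ∈ Set.uIcc (0 : ℝ) 1, HasDerivAt
      (fun s => 2 * b ^ 2 * s + (M - 4 * b * (a + b)) / 2 * s ^ 2
        + (2 * (a + b) ^ 2 - M) / 3 * s ^ 3) (curvatureKernel a b M s) s := fun s _ => by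
    refine ((((hasDerivAt_id' s).const_mul _).fun_add ((hasDerivAt_pow 2 s).const_mul _)).fun_add
      ((hasDerivAt_pow 3 s).const_mul _)).congr_deriv ?_
    rw [curvatureKernel]
    push_cast
    ring
  rw [intervalIntegral.integral_eq_sub_of_hasDerivAt hprim
    ((continuous_curvatureKernel a b M).intervalIntegrable 0 1)]
  ring

theorem integral_curvatureKernel_mul_exp_pos (t : ℝ) (hM : 0 ≤ M) (h : 0 < (a + b) ^ 2 + M) :
    0 < ∫ s in (0 : ℝ)..1, curvatureKernel a b M s * Real.exp (-(t * s)) := by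
  obtain ⟨s, hs, hpos⟩ := exists_curvatureKernel_pos h
  have hcont := continuous_curvatureKernel a b M
  exact intervalIntegral.integral_pos one_pos (by fun_prop)
    (fun r hr => mul_nonneg (curvatureKernel_nonneg a b hM (Set.Ioc_subset_Icc_self hr))
      (Real.exp_pos _).le)
    ⟨s, Set.Ioc_subset_Icc_self hs, mul_pos hpos (Real.exp_pos _)⟩

theorem integral_curvatureKernel_mul_exp_lt (ht : 0 < t) (hM : 0 ≤ M)
    (hMab : 0 ≤ M + 4 * a * b) (h : 0 < (a + b) ^ 2 + M) :
    ∫ s in (0 : ℝ)..1, curvatureKernel a b M s * Real.exp (-(t * s))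
      < 2 / 3 * ((a + b) ^ 2 + M) := by
  obtain ⟨s, hs, hpos⟩ := exists_curvatureKernel_pos h
  have hcont := continuous_curvatureKernel a b M
  calc ∫ s in (0 : ℝ)..1, curvatureKernel a b M s * Real.exp (-(t * s))
      < ∫ s in (0 : ℝ)..1, curvatureKernel a b M s := by
        refine intervalIntegral.integral_lt_integral_of_continuousOn_of_le_of_exists_lt one_pos
          (by fun_prop) (by fun_prop) (fun r hr => ?_) ⟨s, Set.Ioc_subset_Icc_self hs, ?_⟩
        · exact mul_le_of_le_one_right (curvatureKernel_nonneg a b hM (Set.Ioc_subset_Icc_self hr))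
            (Real.exp_le_one_iff.2 (neg_nonpos.2 (mul_nonneg ht.le hr.1.le)))
        · exact mul_lt_of_lt_one_right hpos
            (Real.exp_lt_one_iff.2 (neg_lt_zero.2 (mul_pos ht hs.1)))
    _ = 2 / 3 * (a ^ 2 - a * b + b ^ 2) + M / 6 := integral_curvatureKernel a b M
    _ ≤ 2 / 3 * ((a + b) ^ 2 + M) := by linarith

theorem one_sub_mul_integral_curvatureKernel_le (ht : 0 ≤ t) (a b : ℝ) (hM : 0 ≤ M) :
    (1 - t) * ∫ s in (0 : ℝ)..1, curvatureKernel a b M s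
      ≤ ∫ s in (0 : ℝ)..1, curvatureKernel a b M s * Real.exp (-(t * s)) := by
  have hcont := continuous_curvatureKernel a b M
  rw [← intervalIntegral.integral_const_mul]
  refine intervalIntegral.integral_mono_on zero_le_one
    (Continuous.intervalIntegrable (by fun_prop) _ _)
    (Continuous.intervalIntegrable (by fun_prop) _ _) fun s hs => ?_
  rw [mul_comm]
  refine mul_le_mul_of_nonneg_left ?_ (curvatureKernel_nonneg a b hM hs)
  linarith [Real.add_one_le_exp (-(t * s)), mul_le_of_le_one_right ht hs.2]

theorem integral_quadratic_mul_exp (ht : t ≠ 0) (c₀ c₁ c₂ : ℝ) :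
    ∫ s in (0 : ℝ)..1, (c₀ + c₁ * s + c₂ * s ^ 2) * Real.exp (-(t * s)) =
      (c₀ / t + c₁ / t ^ 2 + 2 * c₂ / t ^ 3)
        - (c₀ / t + c₁ * (1 / t + 1 / t ^ 2) + c₂ * (1 / t + 2 / t ^ 2 + 2 / t ^ 3))
          * Real.exp (-t) := by
  have hprim : ∀ s ∈ Set.uIcc (0 : ℝ) 1, HasDerivAt
      (fun s => -((c₀ / t + c₁ * (s / t + 1 / t ^ 2)
        + c₂ * (s ^ 2 / t + 2 * s / t ^ 2 + 2 / t ^ 3)) * Real.exp (-(t * s))))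
      ((c₀ + c₁ * s + c₂ * s ^ 2) * Real.exp (-(t * s))) s := fun s _ => by
    have hexp : HasDerivAt (fun s => Real.exp (-(t * s))) (Real.exp (-(t * s)) * -(t * 1)) s :=
      ((hasDerivAt_id' s).const_mul t).fun_neg.exp
    have hlin : HasDerivAt (fun s => c₁ * (s / t + 1 / t ^ 2)) (c₁ * (1 / t)) s :=
      (((hasDerivAt_id' s).div_const t).add_const _).const_mul c₁
    have hquad : HasDerivAt (fun s => c₂ * (s ^ 2 / t + 2 * s / t ^ 2 + 2 / t ^ 3))
        (c₂ * ((2 : ℕ) * s ^ (2 - 1) / t + 2 * 1 / t ^ 2)) s :=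
      ((((hasDerivAt_pow 2 s).div_const t).fun_add
        (((hasDerivAt_id' s).const_mul 2).div_const _)).add_const _).const_mul c₂
    refine ((((hlin.const_add (c₀ / t)).fun_add hquad).fun_mul hexp).fun_neg).congr_deriv ?_
    field_simp
    push_cast
    ring
  rw [intervalIntegral.integral_eq_sub_of_hasDerivAt hprim
    (Continuous.intervalIntegrable (by fun_prop) _ _)]
  simp only [mul_zero, neg_zero, Real.exp_zero, mul_one]
  ring

end CurvatureKernel

section SolitonProfile

variable {t : ℝ}

theorem heisF_one_eq (t : ℝ) :
    heisF 1 t = 4 / t * (1 - t + t ^ 2 / 2 - Real.exp (-t)) := by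
  simp [heisF, Finset.sum_range_succ, Nat.factorial]
  ring

theorem hasDerivAt_heisF_one (ht : t ≠ 0) :
    HasDerivAt (heisF 1) (2 * t - heisF 1 t - heisF 1 t / t) t := by
  have hexp : HasDerivAt (fun s => Real.exp (-s)) (Real.exp (-t) * -1) t := (hasDerivAt_neg' t).exp
  have hpoly : HasDerivAt (fun s : ℝ => 1 - s + s ^ 2 / 2) (-1 + (2 : ℕ) * t ^ (2 - 1) / 2) t :=
    ((hasDerivAt_id' t).const_sub 1).fun_add ((hasDerivAt_pow 2 t).div_const 2)
  have hinv : HasDerivAt (fun s : ℝ => 4 / s) _ t :=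
    (hasDerivAt_const t 4).fun_div (hasDerivAt_id' t) ht
  rw [funext heisF_one_eq]
  refine (hinv.fun_mul (hpoly.fun_sub hexp)).congr_deriv ?_
  field_simp
  push_cast
  ring

theorem deriv_deriv_heisF_one (ht : t ≠ 0) : deriv (deriv (heisF 1)) t =
    2 - deriv (heisF 1) t - deriv (heisF 1) t / t + heisF 1 t / t ^ 2 := by
  have hode : deriv (heisF 1) =ᶠ[nhds t] fun s => 2 * s - heisF 1 s - heisF 1 s / s := by
    filter_upwards [isOpen_ne.mem_nhds ht] with s hs using (hasDerivAt_heisF_one hs).deriv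
  have hF : HasDerivAt (heisF 1) (deriv (heisF 1) t) t :=
    (hasDerivAt_heisF_one ht).differentiableAt.hasDerivAt
  have hrhs := (((hasDerivAt_id' t).const_mul 2).fun_sub hF).fun_sub
    (hF.fun_div (hasDerivAt_id' t) ht)
  rw [hode.deriv_eq, hrhs.deriv]
  field_simp
  ring

theorem integral_curvatureKernel_mul_exp (ht : t ≠ 0) (a b M : ℝ) :
    ∫ s in (0 : ℝ)..1, curvatureKernel a b M s * Real.exp (-(t * s)) =
      deriv (deriv (heisF 1)) t / 2 * a ^ 2 + heisF 1 t / t ^ 2 * b ^ 2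
        - (heisF 1 t - t * deriv (heisF 1) t) / (4 * t ^ 2) * (M - 4 * a * b) := by
  have hexpand (s : ℝ) : curvatureKernel a b M s =
      2 * b ^ 2 + (M - 4 * b * (a + b)) * s + (2 * (a + b) ^ 2 - M) * s ^ 2 := by
    rw [curvatureKernel]
    ring
  simp only [hexpand]
  rw [integral_quadratic_mul_exp ht, deriv_deriv_heisF_one ht, (hasDerivAt_heisF_one ht).deriv,
    heisF_one_eq]
  field_simp
  ring

theorem heisF_one_div_sq_eq_integral (ht : t ≠ 0) :
    heisF 1 t / t ^ 2 = ∫ s in (0 : ℝ)..1, curvatureKernel 0 1 0 s * Real.exp (-(t * s)) := by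
  rw [integral_curvatureKernel_mul_exp ht]
  ring

theorem heisF_one_le (ht : 0 < t) : heisF 1 t ≤ 2 * t := by
  rw [heisF_one_eq, div_mul_eq_mul_div, div_le_iff₀ ht]
  linarith [Real.add_one_le_exp (-t)]

theorem tendsto_heisF_one_div_sq_zero :
    Filter.Tendsto (fun t => heisF 1 t / t ^ 2) (nhdsWithin 0 (Set.Ioi 0)) (nhds (2 / 3)) := by
  have hlower : Filter.Tendsto (fun t : ℝ => (1 - t) * (2 / 3)) (nhdsWithin 0 (Set.Ioi 0))
      (nhds (2 / 3)) :=
    tendsto_nhdsWithin_of_tendsto_nhds (Continuous.tendsto' (by fun_prop) _ _ (by norm_num))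
  have hkernel : ∫ s in (0 : ℝ)..1, curvatureKernel 0 1 0 s = 2 / 3 := by
    rw [integral_curvatureKernel]
    norm_num
  refine tendsto_of_tendsto_of_tendsto_of_le_of_le' hlower tendsto_const_nhds ?_ ?_
  · filter_upwards [self_mem_nhdsWithin] with t (ht : 0 < t)
    rw [heisF_one_div_sq_eq_integral ht.ne', ← hkernel]
    exact one_sub_mul_integral_curvatureKernel_le ht.le 0 1 le_rfl
  · filter_upwards [self_mem_nhdsWithin] with t (ht : 0 < t)
    rw [heisF_one_div_sq_eq_integral ht.ne']
    simpa using (integral_curvatureKernel_mul_exp_lt (a := 0) (b := 1) (M := 0) ht le_rfl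
      (by norm_num) (by norm_num)).le

theorem tendsto_heisF_one_div_sq_atTop :
    Filter.Tendsto (fun t => heisF 1 t / t ^ 2) Filter.atTop (nhds 0) := by
  have hupper : Filter.Tendsto (fun t : ℝ => 2 / t) Filter.atTop (nhds 0) :=
    Filter.Tendsto.div_atTop tendsto_const_nhds Filter.tendsto_id
  refine squeeze_zero' ?_ ?_ hupper
  · filter_upwards [Filter.eventually_gt_atTop 0] with t ht
    exact (div_pos (heisF_one_pos ht) (pow_pos ht 2)).le
  · filter_upwards [Filter.eventually_gt_atTop 0] with t ht
    rw [div_le_div_iff₀ (by positivity) ht]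
    nlinarith [heisF_one_le ht]

end SolitonProfile

section Soliton

theorem heisenbergSoliton_hasMomentumProfile : heisenbergSoliton.HasMomentumProfile (heisF 1) :=
  fun _ _ => rfl

theorem inner_curvature_heisenbergSoliton {p : Fin 4 → ℝ} (hp : p ∈ heisenbergSoliton.domain)
    (u v : Fin 4 → ℝ) :
    heisenbergSoliton.inner p (heisenbergSoliton.curvature p u v v) u =
      -∫ s in (0 : ℝ)..1, curvatureKernel (u ⬝ᵥ fiberForm p *ᵥ v) (u ⬝ᵥ baseForm p *ᵥ v)
        (mixedNormSq (heisF 1) p u v) s * Real.exp (-(p 3 * s)) := by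
  rw [heisenbergSoliton_hasMomentumProfile.inner_curvature_eq hp,
    integral_curvatureKernel_mul_exp (ne_of_gt hp)]
  ring

theorem sec_heisenbergSoliton_mem_Ioo {p : Fin 4 → ℝ} (hp : p ∈ heisenbergSoliton.domain)
    {u v : Fin 4 → ℝ} (huv : LinearIndependent ℝ ![u, v]) :
    heisenbergSoliton.sec p u v ∈ Set.Ioo (-2 / 3) 0 := by
  have hg := heisenbergSoliton_hasMomentumProfile
  have hdet := heisenbergSoliton.gram_det_pos hp huv
  have hM := hg.mixedNormSq_nonneg hp u v
  rw [ChartMetric.sec, Set.mem_Ioo, lt_div_iff₀ hdet, div_lt_iff₀ hdet,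
    inner_curvature_heisenbergSoliton hp]
  rw [hg.gram_det_eq hp] at hdet ⊢
  have hlt := integral_curvatureKernel_mul_exp_lt hp hM (hg.mixedNormSq_add_nonneg hp u v) hdet
  have hpos := integral_curvatureKernel_mul_exp_pos (p 3) hM hdet
  constructor <;> linarith

theorem neg_heisF_one_div_sq_mem_secValues {t : ℝ} (ht : 0 < t) :
    -(heisF 1 t / t ^ 2) ∈ heisenbergSoliton.secValues := by
  have hp : ![0, 0, 0, t] ∈ heisenbergSoliton.domain := ht
  refine ⟨_, hp, ![1, 0, 0, 0], ![0, 1, 0, 0], ?_,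
    (heisenbergSoliton_hasMomentumProfile.sec_horizontal hp).symm⟩
  rw [LinearIndependent.pair_iff]
  exact fun r s hrs => ⟨by simpa using congrFun hrs 0, by simpa using congrFun hrs 1⟩

theorem mem_closure_secValues_heisenbergSoliton {l : Filter ℝ} [l.NeBot] {c : ℝ}
    (hl : ∀ᶠ t in l, 0 < t) (hc : Filter.Tendsto (fun t => heisF 1 t / t ^ 2) l (nhds c)) :
    -c ∈ closure heisenbergSoliton.secValues :=
  mem_closure_of_tendsto hc.neg (hl.mono fun _ => neg_heisF_one_div_sq_mem_secValues)

end Soliton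

theorem mainTheorem5 :
    (∀ p ∈ heisenbergSoliton.domain, ∀ u v : Fin 4 → ℝ, LinearIndependent ℝ ![u, v] →
      -2 / 3 < heisenbergSoliton.sec p u v ∧ heisenbergSoliton.sec p u v < 0) ∧
    IsGLB heisenbergSoliton.secValues (-2 / 3) ∧
    IsLUB heisenbergSoliton.secValues 0 := by
  have hbounds : heisenbergSoliton.secValues ⊆ Set.Ioo (-2 / 3) 0 := by
    rintro _ ⟨p, hp, u, v, huv, rfl⟩
    exact sec_heisenbergSoliton_mem_Ioo hp huv
  have hinf : -2 / 3 ∈ closure heisenbergSoliton.secValues := by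
    simpa only [neg_div] using mem_closure_secValues_heisenbergSoliton
      (l := nhdsWithin 0 (Set.Ioi 0)) self_mem_nhdsWithin tendsto_heisF_one_div_sq_zero
  have hsup : 0 ∈ closure heisenbergSoliton.secValues := by
    simpa only [neg_zero] using mem_closure_secValues_heisenbergSoliton
      (Filter.eventually_gt_atTop 0) tendsto_heisF_one_div_sq_atTop
  exact ⟨fun p hp u v huv => sec_heisenbergSoliton_mem_Ioo hp huv,
    isGLB_of_mem_closure (fun κ hκ => (hbounds hκ).1.le) hinf,
    isLUB_of_mem_closure (fun κ hκ => (hbounds hκ).2.le) hsup⟩
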